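/- **Proposition 1.1 (Heisenberg Linking).** Let $\mathbb R^3$ have coordinates $(x,y,z)$. Let $X_1, X_2 : S^1\to\mathbb R^3$ be smooth parametrizations of oriented closed curves $C_1, C_2$ (not necessarily Legendrian) that are disjoint: $X_1(S^1)\cap X_2(S^1)=\emptyset$. (Only smoothness of $X_1,X_2$ and disjointness of their images are assumed.) Let $\theta_1,\theta_2$ be the angular coordinates on $T^2=S^1\times S^1$, oriented by $d\theta_1\wedge d\theta_2$. The linking number is given by the Gauss formula $$\mathrm{lk}(C_1,C_2)=\int_{T^2}(X_1\times X_2)^*\,\Gamma^*\psi,\qquad \Gamma(X_1,X_2)=X_2-X_1,$$ $$\psi=\frac1{4\pi}\,\frac{x\,dy\wedge dz-y\,dx\wedge dz+z\,dx\wedge dy}{(x^2+y^2+z^2)^{3/2}}\in\Omega^2(\mathbb R^3-\{0\}).$$ Let $\widehat\Gamma(X_1,X_2)=X_1^{-1}\cdot X_2$ be the Heisenberg difference, for the Heisenberg multiplication and inverse $$X_1\cdot X_2=(x_1+x_2,\;y_1+y_2,\;z_1+z_2-x_1y_2+x_2y_1),\qquad X^{-1}=(-x,-y,-z),$$ so that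 $\widehat\Gamma(X_1,X_2)=(x_2-x_1,\;y_2-y_1,\;z_2-z_1+x_1y_2-x_2y_1)$. For $\Lambda>0$ let $\chi_\Lambda$ be the heat form on $\mathbb R^3-\{0\}$: $\chi_\Lambda=\varrho_+^*\omega_\Lambda$ where $z>0$ and $\chi_\Lambda=0$ where $z\le 0$, with $$\varrho_+(x,y,z)=\Big(\frac{x}{\sqrt z},\frac{y}{\sqrt z}\Big),\qquad \omega_\Lambda=\frac{\Lambda}{2\pi}\,e^{-\Lambda(x^2+y^2)/2}\,dx\wedge dy .$$ Then for every $\Lambda>0$ the two-form $(X_1\times X_2)^*\,\widehat\Gamma^*\chi_\Lambda$ is integrable over $T^2$, and $$\mathrm{lk}(C_1,C_2)=\int_{T^2}(X_1\times X_2)^*\,\widehat\Gamma^*\chi_\Lambda .$$ -/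

import Mathlib

open scoped Manifold ContDiff

noncomputable section

namespace HeisenbergLinking

/-- The `xy`-plane `ℝ²`. -/
abbrev E2 := EuclideanSpace ℝ (Fin 2)

/-- Euclidean space `ℝ³`, with coordinates `(x, y, z)` in the order `0, 1, 2`. It is also the
underlying space of the Heisenberg group. -/
abbrev E3 := EuclideanSpace ℝ (Fin 3)

/-- Differential two-forms on a normed space `E`. A form that is only meant on an open subset is
given by an arbitrary extension, whose other values are never used. -/
abbrev TwoForm (E : Type*) [NormedAddCommGroup E] [NormedSpace ℝ E] :=
  E → E [⋀^Fin 2]→L[ℝ] ℝ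

/-- The pullback `f^* η` of a two-form. -/
def pullback {E F : Type*} [NormedAddCommGroup E] [NormedSpace ℝ E]
    [NormedAddCommGroup F] [NormedSpace ℝ F] (f : E → F) (η : TwoForm F) : TwoForm E :=
  fun p => (η (f p)).compContinuousLinearMap (fderiv ℝ f p)

/-- The wedge product `α ∧ β` of two covectors. -/
def wedge {E : Type*} [NormedAddCommGroup E] [NormedSpace ℝ E] (α β : E →L[ℝ] ℝ) :
    E [⋀^Fin 2]→L[ℝ] ℝ :=
  ContinuousMultilinearMap.alternatization
    ((ContinuousMultilinearMap.mkPiAlgebra ℝ (Fin 2) ℝ).compContinuousLinearMap ![α, β])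

theorem wedge_apply {E : Type*} [NormedAddCommGroup E] [NormedSpace ℝ E] (α β : E →L[ℝ] ℝ)
    (v : Fin 2 → E) : wedge α β v = α (v 0) * β (v 1) - α (v 1) * β (v 0) := by
  have h : (Finset.univ : Finset (Equiv.Perm (Fin 2))) = {1, Equiv.swap 0 1} := by decide
  have h1 : (1 : Equiv.Perm (Fin 2)) ≠ Equiv.swap 0 1 := by decide
  simp [wedge, ContinuousMultilinearMap.alternatization_apply_apply, h, Finset.sum_pair h1,
    Fin.prod_univ_two, sub_eq_add_neg]

/-- The coordinate covector `dxᵢ` on `ℝⁿ`. -/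
def dcoord {n : ℕ} (i : Fin n) : EuclideanSpace ℝ (Fin n) →L[ℝ] ℝ :=
  EuclideanSpace.proj i

/-- The global angular form on `ℝ³ - {0}`,
`ψ = (1 / 4π) (x dy ∧ dz - y dx ∧ dz + z dx ∧ dy) / (x² + y² + z²)^(3/2)`. -/
def angularForm : TwoForm E3 := fun p =>
  (1 / (4 * Real.pi) / ((p 0) ^ 2 + (p 1) ^ 2 + (p 2) ^ 2) ^ (3 / 2 : ℝ)) •
    (p 0 • wedge (dcoord 1) (dcoord 2) - p 1 • wedge (dcoord 0) (dcoord 2)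
      + p 2 • wedge (dcoord 0) (dcoord 1))

/-- The Gaussian two-form `ω_Λ = (Λ / 2π) exp (-Λ (x² + y²) / 2) dx ∧ dy` on the plane. -/
def gaussianForm (Λ : ℝ) : TwoForm E2 := fun p =>
  (Λ / (2 * Real.pi) * Real.exp (-Λ * ((p 0) ^ 2 + (p 1) ^ 2) / 2)) •
    wedge (dcoord 0) (dcoord 1)

/-- The planar retraction `ϱ₊ (x, y, z) = (x / √z, y / √z)`, meant for `z > 0`. -/
def planarRetraction (p : E3) : E2 := !₂[p 0 / √(p 2), p 1 / √(p 2)]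

open Classical in
/-- The heat form on `ℝ³ - {0}`: `χ_Λ = ϱ₊^* ω_Λ` where `z > 0`, and `χ_Λ = 0` where `z ≤ 0`. -/
def heatForm (Λ : ℝ) : TwoForm E3 := fun p =>
  if 0 < p 2 then pullback planarRetraction (gaussianForm Λ) p else 0

/-- The Heisenberg multiplication
`μ(X₁, X₂) = (x₁ + x₂, y₁ + y₂, z₁ + z₂ - x₁ y₂ + x₂ y₁)`. -/
def heisMul (X₁ X₂ : E3) : E3 :=
  !₂[X₁ 0 + X₂ 0, X₁ 1 + X₂ 1, X₁ 2 + X₂ 2 - X₁ 0 * X₂ 1 + X₂ 0 * X₁ 1]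

/-- The Heisenberg inverse `X⁻¹ = (-x, -y, -z)`. -/
def heisInv (X : E3) : E3 := !₂[-X 0, -X 1, -X 2]

/-- The Heisenberg difference `Γ̂(X₁, X₂) = X₁⁻¹ · X₂`. -/
def heisDiff (P : E3 × E3) : E3 := heisMul (heisInv P.1) P.2

/-- The ordinary difference `Γ(X₁, X₂) = X₂ - X₁`. -/
def euclDiff (P : E3 × E3) : E3 := P.2 - P.1

/-- The map `X₁ × X₂ : T² → ℝ³ × ℝ³`, in the angular coordinates `(θ₁, θ₂)` of the torus
`T² = S¹ × S¹` (that is, lifted to the universal cover `ℝ²`). -/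
def torusMap (X₁ X₂ : Circle → E3) (θ : ℝ × ℝ) : E3 × E3 :=
  (X₁ (Circle.exp θ.1), X₂ (Circle.exp θ.2))

/-- The coefficient `g` of a two-form `g dθ₁ ∧ dθ₂` in the coordinates `(θ₁, θ₂)`. -/
def torusCoeff (η : TwoForm (ℝ × ℝ)) (θ : ℝ × ℝ) : ℝ := η θ ![(1, 0), (0, 1)]

/-- The coordinate square `[0, 2π]²`, which covers the torus once up to a null set. -/
def torusSquare : Set (ℝ × ℝ) := Set.Icc 0 (2 * Real.pi) ×ˢ Set.Icc 0 (2 * Real.pi)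

/-- Integrability over `T²` of a two-form given in the coordinates `(θ₁, θ₂)`. -/
def TorusFormIntegrable (η : TwoForm (ℝ × ℝ)) : Prop :=
  MeasureTheory.IntegrableOn (torusCoeff η) torusSquare

/-- The integral over `T²`, oriented by `dθ₁ ∧ dθ₂`, of a two-form given in the coordinates
`(θ₁, θ₂)`. -/
def torusFormIntegral (η : TwoForm (ℝ × ℝ)) : ℝ :=
  ∫ θ in torusSquare, torusCoeff η θ

/-- The linking number of the closed curves parametrized by `X₁` and `X₂`, given by the Gauss
formula `lk = ∫_{T²} (X₁ × X₂)^* Γ^* ψ`. -/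
def linkingNumber (X₁ X₂ : Circle → E3) : ℝ :=
  torusFormIntegral (pullback (torusMap X₁ X₂) (pullback euclDiff angularForm))

end HeisenbergLinking

end

noncomputable section

namespace HeisenbergLinking

open Filter Topology

/-! The two difference maps share the horizontal coordinates `(x, y)`; only the heights differ, `z`
for the Euclidean and `w` for the Heisenberg one, and these agree where `x = y = 0`. Put `s = x² +
y²`, `R = √(s + z²)`, let `φ` be the polar angle and `E = exp (-Λ s / (2 w))`, read as `0` for `w ≤
0`. Off the axis the pullbacks of `ψ` and `χ_Λ` are `d(-(z/R) dφ / 4π)` and `d(-E dφ / 2π)`, so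
their difference is `dη` with `η = h (x dy - y dx)` and `h = (2E - 1 - z/R) / (4π s)`.

The constant `-1` makes the numerator of `h` vanish on both halves of the axis, so `h` extends
continuously there (`continuousAt_primitiveCoeff`). Since `x dy - y dx` vanishes on the axis,
continuity of `h` already makes the coefficients of `η` differentiable
(`hasFDerivAt_mul_of_continuousAt_of_eq_zero`). Hence `dη` is the difference of the integrands at
every point of the torus (`exists_hasFDerivAt_primitive`), and the divergence theorem with
periodicity gives equal integrals. Disjointness keeps both differences away from the origin. -/

/-! ### The exponential factor as a flat function of the height. -/

/-- The function `exp (-Λ s / (2 w))`, extended by zero to `w ≤ 0`. -/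
def heatExp (Λ s w : ℝ) : ℝ := if 0 < w then Real.exp (-Λ * s / (2 * w)) else 0

theorem heatExp_of_pos {Λ s w : ℝ} (hw : 0 < w) :
    heatExp Λ s w = Real.exp (-Λ * s / (2 * w)) := if_pos hw

theorem heatExp_of_nonpos {Λ s w : ℝ} (hw : w ≤ 0) : heatExp Λ s w = 0 := if_neg hw.not_gt

/-- Off the axis this makes the extension by zero across `w = 0` smooth in `w`, with every
derivative zero there. -/
theorem heatExp_eq_expNegInvGlue {Λ s : ℝ} (hΛ : 0 < Λ) (hs : 0 < s) (w : ℝ) :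
    heatExp Λ s w = expNegInvGlue (2 * w / (Λ * s)) := by
  by_cases hw : 0 < w
  · have h : ¬ 2 * w / (Λ * s) ≤ 0 := not_le.2 (by positivity)
    rw [heatExp_of_pos hw, expNegInvGlue, if_neg h]
    congr 1
    field_simp
  · rw [heatExp_of_nonpos (not_lt.1 hw), expNegInvGlue.zero_of_nonpos]
    exact div_nonpos_of_nonpos_of_nonneg (by linarith) (by positivity)

theorem hasDerivAt_expNegInvGlue (u : ℝ) :
    HasDerivAt expNegInvGlue ((u⁻¹) ^ 2 * expNegInvGlue u) u := by
  simpa using expNegInvGlue.hasDerivAt_polynomial_eval_inv_mul 1 u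

theorem continuous_inv_pow_mul_expNegInvGlue (n : ℕ) :
    Continuous fun u : ℝ => (u⁻¹) ^ n * expNegInvGlue u := by
  simpa using expNegInvGlue.continuous_polynomial_eval_inv_mul (Polynomial.X ^ n)

/-! ### The exterior derivative of the primitive off the axis. -/

section Calculus

variable {F : Type*} [NormedAddCommGroup F] [NormedSpace ℝ F]

theorem hasFDerivAt_heatExp {Λ : ℝ} (hΛ : 0 < Λ) {s w : F → ℝ} {s' w' : F →L[ℝ] ℝ} {p : F}
    (hs : HasFDerivAt s s' p) (hw : HasFDerivAt w w' p) (hpos : 0 < s p) :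
    HasFDerivAt (fun q => heatExp Λ (s q) (w q))
      ((Λ / 2 * heatExp Λ (s p) (w p)) •
        ((s p * (w p)⁻¹ ^ 2) • w' - (w p)⁻¹ • s')) p := by
  have hne : Λ * s p ≠ 0 := by positivity
  have h1 : HasFDerivAt (fun q => 2 * w q / (Λ * s q)) _ p :=
    (hw.const_mul 2).mul ((hasDerivAt_inv hne).comp_hasFDerivAt p (hs.const_mul Λ))
  have h2 := (hasDerivAt_expNegInvGlue (2 * w p / (Λ * s p))).comp_hasFDerivAt p h1
  have h3 : (fun q => heatExp Λ (s q) (w q)) =ᶠ[𝓝 p]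
      expNegInvGlue ∘ fun q => 2 * w q / (Λ * s q) := by
    filter_upwards [hs.continuousAt.eventually (lt_mem_nhds hpos)] with q hq
    exact heatExp_eq_expNegInvGlue hΛ hq _
  refine (h2.congr_of_eventuallyEq h3).congr_fderiv ?_
  ext v
  rw [heatExp_eq_expNegInvGlue hΛ hpos]
  simp
  -- At height zero the convention `0⁻¹ = 0` gives the correct derivative `0`, by flatness.
  by_cases hw0 : w p = 0
  · simp [hw0]
  · have := hpos.ne'
    field_simp
    ring

/-- The coefficient `h` of the primitive `h (x dy - y dx)`, where `w` is the Heisenberg height. -/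
def primitiveCoeff (Λ x y z w : ℝ) : ℝ :=
  if x ^ 2 + y ^ 2 = 0 then
    if 0 < z then (1 / (2 * z ^ 2) - Λ / z) / (4 * Real.pi) else -(1 / (8 * Real.pi * z ^ 2))
  else (2 * heatExp Λ (x ^ 2 + y ^ 2) w - 1 - z / √(x ^ 2 + y ^ 2 + z ^ 2)) /
    (4 * Real.pi * (x ^ 2 + y ^ 2))

/-- The value of the angular form at `(x, y, z)` on a pair of vectors. -/
def angularValue (x y z x₁ y₁ z₁ x₂ y₂ z₂ : ℝ) : ℝ :=
  (x * (y₁ * z₂ - y₂ * z₁) - y * (x₁ * z₂ - x₂ * z₁) + z * (x₁ * y₂ - x₂ * y₁)) /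
    (4 * Real.pi * √(x ^ 2 + y ^ 2 + z ^ 2) ^ 3)

/-- The value of the heat form at `(x, y, w)` on a pair of vectors. -/
def heatValue (Λ x y w x₁ y₁ w₁ x₂ y₂ w₂ : ℝ) : ℝ :=
  Λ / (4 * Real.pi) * heatExp Λ (x ^ 2 + y ^ 2) w *
    (w⁻¹ ^ 2 * (x * (y₁ * w₂ - y₂ * w₁) - y * (x₁ * w₂ - x₂ * w₁))
      + 2 * w⁻¹ * (x₁ * y₂ - x₂ * y₁))

/-- The differential is sorted into multiples of `dw`, `dz` and the radial form `x dx + y dy`; this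
is the shape in which wedging with `x dy - y dx` becomes pure algebra. -/
theorem hasFDerivAt_primitiveCoeff {Λ : ℝ} (hΛ : 0 < Λ) {x y z w : F → ℝ}
    {x' y' z' w' : F →L[ℝ] ℝ} {p : F}
    (hx : HasFDerivAt x x' p) (hy : HasFDerivAt y y' p) (hz : HasFDerivAt z z' p)
    (hw : HasFDerivAt w w' p) (hne : x p ^ 2 + y p ^ 2 ≠ 0) :
    HasFDerivAt (fun q => primitiveCoeff Λ (x q) (y q) (z q) (w q))
      ((Λ * heatExp Λ (x p ^ 2 + y p ^ 2) (w p) / (4 * Real.pi)) • ((w p)⁻¹ ^ 2) • w'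
        - (1 / (4 * Real.pi * √(x p ^ 2 + y p ^ 2 + z p ^ 2) ^ 3)) • z'
        - ((Λ * heatExp Λ (x p ^ 2 + y p ^ 2) (w p) * (w p)⁻¹ * 2
              - z p / √(x p ^ 2 + y p ^ 2 + z p ^ 2) ^ 3) / (4 * Real.pi) / (x p ^ 2 + y p ^ 2)
            + 2 * primitiveCoeff Λ (x p) (y p) (z p) (w p) / (x p ^ 2 + y p ^ 2)) •
          (x p • x' + y p • y')) p := by
  have hpos : 0 < x p ^ 2 + y p ^ 2 := lt_of_le_of_ne (by positivity) hne.symm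
  have hs : HasFDerivAt (fun q => x q ^ 2 + y q ^ 2) _ p := (hx.pow 2).add (hy.pow 2)
  have hR2 : 0 < x p ^ 2 + y p ^ 2 + z p ^ 2 := by positivity
  have hRp := Real.sqrt_pos.2 hR2
  have hRR : HasFDerivAt (fun q => x q ^ 2 + y q ^ 2 + z q ^ 2) _ p := hs.add (hz.pow 2)
  have hR : HasFDerivAt (fun q => √(x q ^ 2 + y q ^ 2 + z q ^ 2)) _ p := hRR.sqrt hR2.ne'
  have hE := hasFDerivAt_heatExp hΛ hs hw hpos
  have hsq := Real.sq_sqrt hR2.le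
  have hzR : HasFDerivAt (fun q => z q / √(x q ^ 2 + y q ^ 2 + z q ^ 2))
      ((1 / √(x p ^ 2 + y p ^ 2 + z p ^ 2) ^ 3) •
        ((x p ^ 2 + y p ^ 2) • z' - z p • (x p • x' + y p • y'))) p := by
    refine (hz.mul ((hasDerivAt_inv hRp.ne').comp_hasFDerivAt p hR)).congr_fderiv ?_
    ext v
    simp only [Function.comp_apply, add_apply, sub_apply,
      smul_apply, smul_eq_mul, nsmul_eq_mul, Nat.cast_ofNat, Nat.add_one_sub_one, pow_one]
    generalize √(x p ^ 2 + y p ^ 2 + z p ^ 2) = R at *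
    field_simp
    linear_combination (z' v) * hsq
  have hnum := ((hE.const_mul 2).sub_const 1).sub hzR
  have hden : 4 * Real.pi * (x p ^ 2 + y p ^ 2) ≠ 0 := by positivity
  have hh := hnum.mul ((hasDerivAt_inv hden).comp_hasFDerivAt p (hs.const_mul (4 * Real.pi)))
  refine (hh.congr_of_eventuallyEq (?_ : _ =ᶠ[𝓝 p] _)).congr_fderiv ?_
  · filter_upwards [hs.continuousAt.eventually (lt_mem_nhds hpos)] with q hq
    exact if_neg hq.ne'
  rw [primitiveCoeff, if_neg hne]
  ext v
  simp only [Function.comp_apply, add_apply, sub_apply,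
    smul_apply, smul_eq_mul, nsmul_eq_mul, Nat.cast_ofNat,
    Nat.add_one_sub_one, pow_one, Pi.sub_apply]
  clear hsq hzR
  generalize √(x p ^ 2 + y p ^ 2 + z p ^ 2) = R at *
  generalize heatExp Λ (x p ^ 2 + y p ^ 2) (w p) = E
  generalize (w p)⁻¹ = u
  field_simp
  ring

/-- This evaluates `dh ∧ (x dy - y dx) + 2h dx ∧ dy`. Because `(x dx + y dy) ∧ (x dy - y dx) = s dx
∧ dy`, the two terms containing `h` itself cancel. -/
theorem primitiveCoeff_identity {X Y Z L U h X₁ Y₁ Z₁ W₁ X₂ Y₂ Z₂ W₂ s c : ℝ}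
    (hs : X ^ 2 + Y ^ 2 = s) (hne : s ≠ 0) :
    (c * (U ^ 2 * W₁) - L * Z₁ - ((c * U * 2 - Z * L) / s + 2 * h / s) * (X * X₁ + Y * Y₁))
      * (X * Y₂ - Y * X₂)
    - (c * (U ^ 2 * W₂) - L * Z₂ - ((c * U * 2 - Z * L) / s + 2 * h / s) * (X * X₂ + Y * Y₂))
      * (X * Y₁ - Y * X₁) + 2 * h * (X₁ * Y₂ - X₂ * Y₁) =
    (X * (Y₁ * Z₂ - Y₂ * Z₁) - Y * (X₁ * Z₂ - X₂ * Z₁) + Z * (X₁ * Y₂ - X₂ * Y₁)) * L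
    - c * (U ^ 2 * (X * (Y₁ * W₂ - Y₂ * W₁) - Y * (X₁ * W₂ - X₂ * W₁))
      + 2 * U * (X₁ * Y₂ - X₂ * Y₁)) := by
  subst hs
  field_simp
  ring

end Calculus

/-! ### Continuity across height zero and across the axis. -/

theorem continuousAt_inv_pow_mul_heatExp {T : Type*} [TopologicalSpace T] {x y w : T → ℝ} {p : T} {Λ : ℝ}
    (hΛ : 0 < Λ) (hx : ContinuousAt x p) (hy : ContinuousAt y p) (hw : ContinuousAt w p)
    (hne : x p ^ 2 + y p ^ 2 ≠ 0 ∨ w p ≠ 0) (n : ℕ) :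
    ContinuousAt (fun q => (w q)⁻¹ ^ n * heatExp Λ (x q ^ 2 + y q ^ 2) (w q)) p := by
  have hs : ContinuousAt (fun q => x q ^ 2 + y q ^ 2) p := (hx.pow 2).add (hy.pow 2)
  by_cases h0 : x p ^ 2 + y p ^ 2 = 0
  · have hw0 : w p ≠ 0 := hne.resolve_left (not_not.2 h0)
    rcases lt_or_gt_of_ne hw0 with hneg | hpos
    · refine (continuousAt_const (y := (0 : ℝ))).congr ?_
      filter_upwards [hw.eventually (gt_mem_nhds hneg)] with q hq
      rw [heatExp_of_nonpos hq.le, mul_zero]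
    · have h2 : 2 * w p ≠ 0 := by positivity
      refine (((hw.inv₀ hw0).pow n).mul (((hs.const_mul (-Λ)).div
        (hw.const_mul 2) h2).rexp)).congr ?_
      filter_upwards [hw.eventually (lt_mem_nhds hpos)] with q hq
      simp [heatExp_of_pos hq]
  · have hpos : 0 < x p ^ 2 + y p ^ 2 := lt_of_le_of_ne (by positivity) (Ne.symm h0)
    have hu : ContinuousAt (fun q => 2 * w q / (Λ * (x q ^ 2 + y q ^ 2))) p :=
      (hw.const_mul 2).div (hs.const_mul Λ) (by positivity)
    -- With `u = 2w / (Λ s)` one has `w⁻¹ = (Λ s / 2)⁻¹ u⁻¹`, and the flat function absorbs any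
    -- power of `u⁻¹`.
    have hc := ((continuous_inv_pow_mul_expNegInvGlue n).continuousAt).comp hu
    refine ((((hs.const_mul Λ).div_const 2).inv₀ (by positivity)).pow n).mul hc |>.congr ?_
    filter_upwards [hs.eventually (lt_mem_nhds hpos)] with q hq
    simp only [Pi.mul_apply, Pi.pow_apply, Pi.inv_apply, Function.comp_apply]
    rw [heatExp_eq_expNegInvGlue hΛ hq, ← mul_assoc, ← mul_pow]
    congr 2
    by_cases hw0 : w q = 0
    · simp [hw0]
    · field_simp

/-- The quotient by `s` is a removable `0/0`; the values prescribed on the axis are its limits,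
found from `z/R ≈ ±(1 - s / (2z²))` and `E ≈ 1 - Λ s / (2z)` for `z > 0`, `E = 0` for `z < 0`. -/
theorem continuousAt_primitiveCoeff {T : Type*} [TopologicalSpace T] {x y z w : T → ℝ} {p : T}
    {Λ : ℝ} (hΛ : 0 < Λ) (hx : ContinuousAt x p) (hy : ContinuousAt y p) (hz : ContinuousAt z p)
    (hw : ContinuousAt w p) (h0 : x p ^ 2 + y p ^ 2 = 0) (hz0 : z p ≠ 0)
    (hzw : ∀ q, x q ^ 2 + y q ^ 2 = 0 → w q = z q) :
    ContinuousAt (fun q => primitiveCoeff Λ (x q) (y q) (z q) (w q)) p := by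
  have hs : ContinuousAt (fun q => x q ^ 2 + y q ^ 2) p := (hx.pow 2).add (hy.pow 2)
  have hR : ContinuousAt (fun q => √(x q ^ 2 + y q ^ 2 + z q ^ 2)) p := (hs.add (hz.pow 2)).sqrt
  have hwp := hzw p h0
  have hpi := Real.pi_pos
  rcases lt_or_gt_of_ne hz0 with hneg | hpos
  · have hd : 4 * Real.pi * (√(x p ^ 2 + y p ^ 2 + z p ^ 2) *
        (√(x p ^ 2 + y p ^ 2 + z p ^ 2) - z p)) ≠ 0 := by
      rw [h0, zero_add, Real.sqrt_sq_eq_abs, abs_of_neg hneg]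
      have : z p * z p ≠ 0 := mul_ne_zero hz0 hz0
      have : -z p * (-z p - z p) ≠ 0 := by intro h; apply this; linarith
      positivity
    -- Here `E = 0`, and `R² - z² = s` gives `(-1 - z/R) / s = -1 / (R (R - z))`, which is regular
    -- for `z < 0`.
    refine ((continuousAt_const (y := (-1 : ℝ))).div
      ((hR.mul (hR.sub hz)).const_mul (4 * Real.pi)) hd).congr ?_
    filter_upwards [hz.eventually (gt_mem_nhds hneg), hw.eventually (gt_mem_nhds (hwp ▸ hneg))]
      with q hzq hwq
    rw [primitiveCoeff]
    simp only [Pi.div_apply, Pi.sub_apply, Pi.mul_apply]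
    split_ifs with h1 h2
    · exact absurd h2 hzq.not_gt
    · rw [h1, zero_add, Real.sqrt_sq_eq_abs, abs_of_neg hzq]
      field_simp
      ring
    · rw [heatExp_of_nonpos hwq.le]
      have hsp : 0 < x q ^ 2 + y q ^ 2 := lt_of_le_of_ne (by positivity) (Ne.symm h1)
      have hR2 : 0 < x q ^ 2 + y q ^ 2 + z q ^ 2 := by positivity
      have hsq := Real.sq_sqrt hR2.le
      have hRp := Real.sqrt_pos.2 hR2
      generalize √(x q ^ 2 + y q ^ 2 + z q ^ 2) = R at *
      have : R - z q ≠ 0 := by linarith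
      generalize x q ^ 2 + y q ^ 2 = s at *
      field_simp
      linear_combination hsq
  -- Split the numerator as `(1 - z/R) - 2(1 - E)`. The first part over `s` is `1 / (R (R + z))`;
  -- the second is `Λ/w` times `(1 - exp (-u)) / u` at `u = Λ s / (2w)`, whose singularity `dslope`
  -- removes.
  · have hφ : ContinuousAt (dslope (fun u : ℝ => -Real.exp (-u)) 0) 0 := by
      rw [continuousAt_dslope_same]
      fun_prop
    have hφ0 : dslope (fun u : ℝ => -Real.exp (-u)) 0 0 = 1 := by
      rw [dslope_same]
      have : HasDerivAt (fun u : ℝ => -Real.exp (-u)) 1 0 := by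
        simpa using ((hasDerivAt_neg (0 : ℝ)).exp).fun_neg
      exact this.deriv
    have hu : ContinuousAt (fun q => Λ * (x q ^ 2 + y q ^ 2) / (2 * w q)) p :=
      (hs.const_mul Λ).div (hw.const_mul 2) (by rw [hwp]; positivity)
    have hu0 : Λ * (x p ^ 2 + y p ^ 2) / (2 * w p) = 0 := by simp [h0]
    have hc : ContinuousAt (fun q => dslope (fun u : ℝ => -Real.exp (-u)) 0
        (Λ * (x q ^ 2 + y q ^ 2) / (2 * w q))) p :=
      ContinuousAt.comp_of_eq (f := fun q => Λ * (x q ^ 2 + y q ^ 2) / (2 * w q)) hφ hu hu0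
    have hd : √(x p ^ 2 + y p ^ 2 + z p ^ 2) * (√(x p ^ 2 + y p ^ 2 + z p ^ 2) + z p) ≠ 0 := by
      have hR2 : 0 < x p ^ 2 + y p ^ 2 + z p ^ 2 := by positivity
      have hRp := Real.sqrt_pos.2 hR2
      positivity
    refine ((((continuousAt_const (y := (1 : ℝ))).div (hR.mul (hR.add hz)) hd).sub
      (((continuousAt_const (y := Λ)).div hw (hwp ▸ hz0)).mul hc)).div_const
        (4 * Real.pi)).congr ?_
    filter_upwards [hz.eventually (lt_mem_nhds hpos), hw.eventually (lt_mem_nhds (hwp ▸ hpos))]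
      with q hzq hwq
    rw [primitiveCoeff]
    simp only [Pi.div_apply, Pi.sub_apply, Pi.mul_apply, Pi.add_apply]
    split_ifs with h1
    · rw [h1, hzw q h1, mul_zero, zero_div, hφ0, zero_add, Real.sqrt_sq_eq_abs, abs_of_pos hzq]
      field_simp
      ring
    · rw [heatExp_of_pos hwq]
      have hsp : 0 < x q ^ 2 + y q ^ 2 := lt_of_le_of_ne (by positivity) (Ne.symm h1)
      have hR2 : 0 < x q ^ 2 + y q ^ 2 + z q ^ 2 := by positivity
      have hsq := Real.sq_sqrt hR2.le
      have hRp := Real.sqrt_pos.2 hR2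
      have hne : Λ * (x q ^ 2 + y q ^ 2) / (2 * w q) ≠ 0 := by positivity
      rw [dslope_of_ne _ hne, slope_def_field, neg_mul, neg_div]
      generalize Real.exp (-(Λ * (x q ^ 2 + y q ^ 2) / (2 * w q))) = E
      rw [neg_zero, Real.exp_zero]
      generalize √(x q ^ 2 + y q ^ 2 + z q ^ 2) = R at *
      have : R + z q ≠ 0 := by positivity
      generalize x q ^ 2 + y q ^ 2 = s at *
      field_simp
      linear_combination (-(Λ * s)) * hsq

/-- Since `u` is `O(q - p)`, the error `(h q - h p) * u q` is `o(q - p)`; no derivative of `h` is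
needed. -/
theorem hasFDerivAt_mul_of_continuousAt_of_eq_zero {F : Type*} [NormedAddCommGroup F]
    [NormedSpace ℝ F] {h u : F → ℝ} {u' : F →L[ℝ] ℝ} {p : F} (hh : ContinuousAt h p)
    (hu : HasFDerivAt u u' p) (hu0 : u p = 0) :
    HasFDerivAt (fun q => h q * u q) (h p • u') p := by
  have h1 : HasFDerivAt (fun q => h p * u q) (h p • u') p := hu.const_mul (h p)
  have h2 : HasFDerivAt (fun q => (h q - h p) * u q) (0 : F →L[ℝ] ℝ) p := by
    rw [hasFDerivAt_iff_isLittleO]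
    have ho : (fun q => h q - h p) =o[𝓝 p] (fun _ => (1 : ℝ)) := by
      rw [Asymptotics.isLittleO_one_iff]
      simpa using hh.tendsto.sub_const (h p)
    have hO : u =O[𝓝 p] fun q => q - p := by
      simpa [hu0] using hu.isBigO_sub
    have := ho.mul_isBigO hO.norm_right
    simpa [hu0] using this
  refine ((h1.add h2).congr_of_eventuallyEq (.of_forall fun q => ?_)).congr_fderiv (add_zero _)
  simp only [Pi.add_apply]
  ring

/-! ### Transfer to the torus and the divergence theorem. -/

/-- Coordinates of the Euclidean difference of two curves, given by their coordinates `a`, `b`. -/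
def diffCoord (a b : Fin 3 → ℝ → ℝ) (i : Fin 3) (θ : ℝ × ℝ) : ℝ := b i θ.2 - a i θ.1

/-- The height of the Heisenberg difference of two curves, given by their coordinates `a`, `b`. -/
def heisHeight (a b : Fin 3 → ℝ → ℝ) (θ : ℝ × ℝ) : ℝ :=
  b 2 θ.2 - a 2 θ.1 + a 0 θ.1 * b 1 θ.2 - a 1 θ.1 * b 0 θ.2

section Torus

variable {a b : Fin 3 → ℝ → ℝ}

/-- The Gauss integrand. -/
def gaussIntegrand (a b : Fin 3 → ℝ → ℝ) (θ : ℝ × ℝ) : ℝ :=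
  angularValue (diffCoord a b 0 θ) (diffCoord a b 1 θ) (diffCoord a b 2 θ)
    (-deriv (a 0) θ.1) (-deriv (a 1) θ.1) (-deriv (a 2) θ.1)
    (deriv (b 0) θ.2) (deriv (b 1) θ.2) (deriv (b 2) θ.2)

/-- The integrand of the heat form, pulled back by the Heisenberg difference. -/
def heatIntegrand (Λ : ℝ) (a b : Fin 3 → ℝ → ℝ) (θ : ℝ × ℝ) : ℝ :=
  heatValue Λ (diffCoord a b 0 θ) (diffCoord a b 1 θ) (heisHeight a b θ)
    (-deriv (a 0) θ.1) (-deriv (a 1) θ.1)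
    (-deriv (a 2) θ.1 + deriv (a 0) θ.1 * b 1 θ.2 - deriv (a 1) θ.1 * b 0 θ.2)
    (deriv (b 0) θ.2) (deriv (b 1) θ.2)
    (deriv (b 2) θ.2 + a 0 θ.1 * deriv (b 1) θ.2 - a 1 θ.1 * deriv (b 0) θ.2)

/-- The coefficient of the primitive on the torus. -/
def torusPrimitive (Λ : ℝ) (a b : Fin 3 → ℝ → ℝ) (θ : ℝ × ℝ) : ℝ :=
  primitiveCoeff Λ (diffCoord a b 0 θ) (diffCoord a b 1 θ) (diffCoord a b 2 θ) (heisHeight a b θ)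

/-- The twist `x₁ y₂ - x₂ y₁` vanishes when the two points have the same horizontal projection. -/
theorem heisHeight_eq {θ : ℝ × ℝ} (h : diffCoord a b 0 θ ^ 2 + diffCoord a b 1 θ ^ 2 = 0) :
    heisHeight a b θ = diffCoord a b 2 θ := by
  have h0 : diffCoord a b 0 θ = 0 := by nlinarith [sq_nonneg (diffCoord a b 1 θ)]
  have h1 : diffCoord a b 1 θ = 0 := by nlinarith [sq_nonneg (diffCoord a b 0 θ)]
  simp only [diffCoord, heisHeight] at *
  linear_combination a 0 θ.1 * h1 - a 1 θ.1 * h0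

theorem hasFDerivAt_comp_fst {f : ℝ → ℝ} (hf : Differentiable ℝ f) (θ : ℝ × ℝ) :
    HasFDerivAt (fun q : ℝ × ℝ => f q.1) (deriv f θ.1 • ContinuousLinearMap.fst ℝ ℝ ℝ) θ :=
  (hf θ.1).hasDerivAt.comp_hasFDerivAt θ hasFDerivAt_fst

theorem hasFDerivAt_comp_snd {f : ℝ → ℝ} (hf : Differentiable ℝ f) (θ : ℝ × ℝ) :
    HasFDerivAt (fun q : ℝ × ℝ => f q.2) (deriv f θ.2 • ContinuousLinearMap.snd ℝ ℝ ℝ) θ :=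
  (hf θ.2).hasDerivAt.comp_hasFDerivAt θ hasFDerivAt_snd

theorem hasFDerivAt_diffCoord (ha : ∀ i, Differentiable ℝ (a i))
    (hb : ∀ i, Differentiable ℝ (b i)) (i : Fin 3) (θ : ℝ × ℝ) :
    HasFDerivAt (diffCoord a b i) (deriv (b i) θ.2 • ContinuousLinearMap.snd ℝ ℝ ℝ
      - deriv (a i) θ.1 • ContinuousLinearMap.fst ℝ ℝ ℝ) θ :=
  (hasFDerivAt_comp_snd (hb i) θ).sub (hasFDerivAt_comp_fst (ha i) θ)

theorem hasFDerivAt_heisHeight (ha : ∀ i, Differentiable ℝ (a i))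
    (hb : ∀ i, Differentiable ℝ (b i)) (θ : ℝ × ℝ) :
    HasFDerivAt (heisHeight a b)
      ((-deriv (a 2) θ.1 + deriv (a 0) θ.1 * b 1 θ.2 - deriv (a 1) θ.1 * b 0 θ.2) •
          ContinuousLinearMap.fst ℝ ℝ ℝ +
        (deriv (b 2) θ.2 + a 0 θ.1 * deriv (b 1) θ.2 - a 1 θ.1 * deriv (b 0) θ.2) •
          ContinuousLinearMap.snd ℝ ℝ ℝ) θ := by
  have ha' := fun i => hasFDerivAt_comp_fst (ha i) θ
  have hb' := fun i => hasFDerivAt_comp_snd (hb i) θ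
  refine ((((hb' 2).sub (ha' 2)).add ((ha' 0).mul (hb' 1))).sub
    ((ha' 1).mul (hb' 0))).congr_fderiv ?_
  ext
  · simp
    ring
  · simp

theorem continuousAt_torusPrimitive {Λ : ℝ} (hΛ : 0 < Λ) (ha : ∀ i, Differentiable ℝ (a i))
    (hb : ∀ i, Differentiable ℝ (b i)) {θ : ℝ × ℝ} (hne : ∃ i, a i θ.1 ≠ b i θ.2)
    (h0 : diffCoord a b 0 θ ^ 2 + diffCoord a b 1 θ ^ 2 = 0) :
    ContinuousAt (torusPrimitive Λ a b) θ := by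
  have hd := fun i => (hasFDerivAt_diffCoord ha hb i θ).continuousAt
  refine continuousAt_primitiveCoeff hΛ (hd 0) (hd 1) (hd 2)
    (hasFDerivAt_heisHeight ha hb θ).continuousAt h0 ?_ fun _ => heisHeight_eq
  intro h2
  have h0' : diffCoord a b 0 θ = 0 := by nlinarith [sq_nonneg (diffCoord a b 1 θ)]
  have h1 : diffCoord a b 1 θ = 0 := by nlinarith [sq_nonneg (diffCoord a b 0 θ)]
  obtain ⟨i, hi⟩ := hne
  apply hi
  simp only [diffCoord, sub_eq_zero] at *
  fin_cases i <;> simp [*]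

/-- The coefficient of `dθ₂` in the primitive. -/
def primitiveSnd (Λ : ℝ) (a b : Fin 3 → ℝ → ℝ) (θ : ℝ × ℝ) : ℝ :=
  torusPrimitive Λ a b θ *
    (diffCoord a b 0 θ * deriv (b 1) θ.2 - diffCoord a b 1 θ * deriv (b 0) θ.2)

/-- Minus the coefficient of `dθ₁` in the primitive. -/
def primitiveFst (Λ : ℝ) (a b : Fin 3 → ℝ → ℝ) (θ : ℝ × ℝ) : ℝ :=
  torusPrimitive Λ a b θ *
    (diffCoord a b 0 θ * deriv (a 1) θ.1 - diffCoord a b 1 θ * deriv (a 0) θ.1)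

theorem exists_hasFDerivAt_primitive {Λ : ℝ} (hΛ : 0 < Λ) (ha : ∀ i, ContDiff ℝ 2 (a i))
    (hb : ∀ i, ContDiff ℝ 2 (b i)) {θ : ℝ × ℝ} (hne : ∃ i, a i θ.1 ≠ b i θ.2) :
    ∃ f' g' : ℝ × ℝ →L[ℝ] ℝ, HasFDerivAt (primitiveSnd Λ a b) f' θ ∧
      HasFDerivAt (primitiveFst Λ a b) g' θ ∧
      f' (1, 0) + g' (0, 1) = gaussIntegrand a b θ - heatIntegrand Λ a b θ := by
  have hda := fun i => (ha i).differentiable two_ne_zero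
  have hdb := fun i => (hb i).differentiable two_ne_zero
  have hda' := fun i => hasFDerivAt_comp_fst
    (((contDiff_succ_iff_deriv (n := 1)).1 (ha i)).2.2.differentiable one_ne_zero) θ
  have hdb' := fun i => hasFDerivAt_comp_snd
    (((contDiff_succ_iff_deriv (n := 1)).1 (hb i)).2.2.differentiable one_ne_zero) θ
  have hd := fun i => hasFDerivAt_diffCoord hda hdb i θ
  have hu := ((hd 0).mul (hdb' 1)).sub ((hd 1).mul (hdb' 0))
  have hv := ((hd 0).mul (hda' 1)).sub ((hd 1).mul (hda' 0))
  by_cases h0 : diffCoord a b 0 θ ^ 2 + diffCoord a b 1 θ ^ 2 = 0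
  -- On the axis only `2h dx ∧ dy` survives in `dη`, so the prescribed axis value of `h` has to
  -- match the two integrands.
  · have hc := continuousAt_torusPrimitive hΛ hda hdb hne h0
    have hx : diffCoord a b 0 θ = 0 := by nlinarith [sq_nonneg (diffCoord a b 1 θ)]
    have hy : diffCoord a b 1 θ = 0 := by nlinarith [sq_nonneg (diffCoord a b 0 θ)]
    refine ⟨_, _, hasFDerivAt_mul_of_continuousAt_of_eq_zero hc hu (by simp [hx, hy]),
      hasFDerivAt_mul_of_continuousAt_of_eq_zero hc hv (by simp [hx, hy]), ?_⟩
    have hz : diffCoord a b 2 θ ≠ 0 := by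
      intro h2
      obtain ⟨i, hi⟩ := hne
      apply hi
      simp only [diffCoord, sub_eq_zero] at hx hy h2
      fin_cases i <;> simp [*]
    have hw := heisHeight_eq h0
    simp only [torusPrimitive, primitiveCoeff, gaussIntegrand, heatIntegrand, angularValue,
      heatValue, hw, hx, hy]
    rcases lt_or_gt_of_ne hz with hneg | hpos
    · simp [hneg.not_gt, heatExp_of_nonpos hneg.le, Real.sqrt_sq_eq_abs, abs_of_neg hneg]
      field_simp
      ring
    · simp [hpos, heatExp_of_pos hpos, Real.sqrt_sq_eq_abs, abs_of_pos hpos]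
      field_simp
      ring
  · have hh := hasFDerivAt_primitiveCoeff hΛ (hd 0) (hd 1) (hd 2)
      (hasFDerivAt_heisHeight hda hdb θ) h0
    refine ⟨_, _, hh.mul hu, hh.mul hv, ?_⟩
    have := primitiveCoeff_identity
      (X := diffCoord a b 0 θ) (Y := diffCoord a b 1 θ) (Z := diffCoord a b 2 θ)
      (L := 1 / (4 * Real.pi *
        √(diffCoord a b 0 θ ^ 2 + diffCoord a b 1 θ ^ 2 + diffCoord a b 2 θ ^ 2) ^ 3))
      (U := (heisHeight a b θ)⁻¹) (h := torusPrimitive Λ a b θ)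
      (X₁ := -deriv (a 0) θ.1) (Y₁ := -deriv (a 1) θ.1) (Z₁ := -deriv (a 2) θ.1)
      (W₁ := -deriv (a 2) θ.1 + deriv (a 0) θ.1 * b 1 θ.2 - deriv (a 1) θ.1 * b 0 θ.2)
      (X₂ := deriv (b 0) θ.2) (Y₂ := deriv (b 1) θ.2) (Z₂ := deriv (b 2) θ.2)
      (W₂ := deriv (b 2) θ.2 + a 0 θ.1 * deriv (b 1) θ.2 - a 1 θ.1 * deriv (b 0) θ.2)
      (c := Λ * heatExp Λ (diffCoord a b 0 θ ^ 2 + diffCoord a b 1 θ ^ 2) (heisHeight a b θ)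
        / (4 * Real.pi)) rfl h0
    simp only [gaussIntegrand, heatIntegrand, angularValue, heatValue, add_apply, sub_apply,
      smul_apply, smul_eq_mul, ContinuousLinearMap.coe_fst', ContinuousLinearMap.coe_snd',
      mul_one, mul_zero, add_zero, zero_add, sub_zero, zero_sub]
    rw [torusPrimitive] at this
    generalize primitiveCoeff Λ _ _ _ _ = h at *
    generalize heatExp Λ _ _ = E at *
    generalize √(_ ^ 2 + _ ^ 2 + _ ^ 2) = R at *
    generalize (heisHeight a b θ)⁻¹ = U at *
    generalize diffCoord a b 0 θ = X at *
    generalize diffCoord a b 1 θ = Y at *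
    generalize diffCoord a b 2 θ = Z at *
    linear_combination this

theorem sq_add_sq_add_sq_diffCoord_ne_zero {θ : ℝ × ℝ} (hne : ∃ i, a i θ.1 ≠ b i θ.2) :
    diffCoord a b 0 θ ^ 2 + diffCoord a b 1 θ ^ 2 + diffCoord a b 2 θ ^ 2 ≠ 0 := by
  intro h
  have h0 : diffCoord a b 0 θ = 0 := by
    nlinarith [sq_nonneg (diffCoord a b 1 θ), sq_nonneg (diffCoord a b 2 θ)]
  have h1 : diffCoord a b 1 θ = 0 := by
    nlinarith [sq_nonneg (diffCoord a b 0 θ), sq_nonneg (diffCoord a b 2 θ)]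
  have h2 : diffCoord a b 2 θ = 0 := by
    nlinarith [sq_nonneg (diffCoord a b 0 θ), sq_nonneg (diffCoord a b 1 θ)]
  obtain ⟨i, hi⟩ := hne
  apply hi
  simp only [diffCoord, sub_eq_zero] at h0 h1 h2
  fin_cases i <;> simp [*]

theorem continuous_gaussIntegrand (ha : ∀ i, ContDiff ℝ 2 (a i)) (hb : ∀ i, ContDiff ℝ 2 (b i))
    (hne : ∀ θ : ℝ × ℝ, ∃ i, a i θ.1 ≠ b i θ.2) : Continuous (gaussIntegrand a b) := by
  have ha' := fun i => (ha i).continuous_deriv one_le_two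
  have hb' := fun i => (hb i).continuous_deriv one_le_two
  have hca := fun i => (ha i).continuous
  have hcb := fun i => (hb i).continuous
  have hd : ∀ i, Continuous (diffCoord a b i) := fun i => by unfold diffCoord; fun_prop
  have hpos := fun θ => (sq_add_sq_add_sq_diffCoord_ne_zero (hne θ)).symm.lt_of_le
    (by positivity)
  unfold gaussIntegrand angularValue
  refine Continuous.div (by fun_prop) (by fun_prop) fun θ => ?_
  have := Real.sqrt_pos.2 (hpos θ)
  positivity

theorem continuous_heatIntegrand {Λ : ℝ} (hΛ : 0 < Λ) (ha : ∀ i, ContDiff ℝ 2 (a i))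
    (hb : ∀ i, ContDiff ℝ 2 (b i)) (hne : ∀ θ : ℝ × ℝ, ∃ i, a i θ.1 ≠ b i θ.2) :
    Continuous (heatIntegrand Λ a b) := by
  have ha' := fun i => (ha i).continuous_deriv one_le_two
  have hb' := fun i => (hb i).continuous_deriv one_le_two
  have hca := fun i => (ha i).continuous
  have hcb := fun i => (hb i).continuous
  have hd : ∀ i, Continuous (diffCoord a b i) := fun i => by unfold diffCoord; fun_prop
  have hw : Continuous (heisHeight a b) := by unfold heisHeight; fun_prop
  have hE : ∀ n : ℕ, Continuous fun θ => (heisHeight a b θ)⁻¹ ^ n *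
      heatExp Λ (diffCoord a b 0 θ ^ 2 + diffCoord a b 1 θ ^ 2) (heisHeight a b θ) := by
    refine fun n => continuous_iff_continuousAt.2 fun θ => continuousAt_inv_pow_mul_heatExp hΛ
      (hd 0).continuousAt (hd 1).continuousAt hw.continuousAt ?_ n
    by_contra! h
    have h2 := heisHeight_eq h.1
    exact sq_add_sq_add_sq_diffCoord_ne_zero (hne θ) (by rw [h.1, ← h2, h.2]; simp)
  have h1 := hE 1
  have h2 := hE 2
  have : Continuous fun θ => Λ / (4 * Real.pi) *
      (((heisHeight a b θ)⁻¹ ^ 2 *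
          heatExp Λ (diffCoord a b 0 θ ^ 2 + diffCoord a b 1 θ ^ 2) (heisHeight a b θ)) *
        (diffCoord a b 0 θ * (-deriv (a 1) θ.1 *
              (deriv (b 2) θ.2 + a 0 θ.1 * deriv (b 1) θ.2 - a 1 θ.1 * deriv (b 0) θ.2)
            - deriv (b 1) θ.2 *
              (-deriv (a 2) θ.1 + deriv (a 0) θ.1 * b 1 θ.2 - deriv (a 1) θ.1 * b 0 θ.2))
          - diffCoord a b 1 θ * (-deriv (a 0) θ.1 *
              (deriv (b 2) θ.2 + a 0 θ.1 * deriv (b 1) θ.2 - a 1 θ.1 * deriv (b 0) θ.2)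
            - deriv (b 0) θ.2 *
              (-deriv (a 2) θ.1 + deriv (a 0) θ.1 * b 1 θ.2 - deriv (a 1) θ.1 * b 0 θ.2)))
      + 2 * ((heisHeight a b θ)⁻¹ ^ 1 *
          heatExp Λ (diffCoord a b 0 θ ^ 2 + diffCoord a b 1 θ ^ 2) (heisHeight a b θ)) *
        (-deriv (a 0) θ.1 * deriv (b 1) θ.2 - deriv (b 0) θ.2 * -deriv (a 1) θ.1)) := by
    fun_prop
  refine this.congr fun θ => ?_
  simp only [heatIntegrand, heatValue]
  ring

theorem integral_gaussIntegrand_eq {Λ : ℝ} (hΛ : 0 < Λ) (ha : ∀ i, ContDiff ℝ 2 (a i))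
    (hb : ∀ i, ContDiff ℝ 2 (b i)) (hne : ∀ θ : ℝ × ℝ, ∃ i, a i θ.1 ≠ b i θ.2)
    (hpa : ∀ i, a i (2 * Real.pi) = a i 0) (hpb : ∀ i, b i (2 * Real.pi) = b i 0) :
    MeasureTheory.IntegrableOn (heatIntegrand Λ a b) torusSquare ∧
      ∫ θ in torusSquare, gaussIntegrand a b θ = ∫ θ in torusSquare, heatIntegrand Λ a b θ := by
  have hsq : torusSquare = Set.Icc ((0 : ℝ), (0 : ℝ)) (2 * Real.pi, 2 * Real.pi) :=
    Set.Icc_prod_Icc _ _ _ _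
  have hpi := Real.pi_pos
  have hG := continuous_gaussIntegrand ha hb hne
  have hH := continuous_heatIntegrand hΛ ha hb hne
  have hGi : MeasureTheory.IntegrableOn (gaussIntegrand a b) torusSquare := by
    rw [hsq]; exact hG.continuousOn.integrableOn_compact isCompact_Icc
  have hHi : MeasureTheory.IntegrableOn (heatIntegrand Λ a b) torusSquare := by
    rw [hsq]; exact hH.continuousOn.integrableOn_compact isCompact_Icc
  refine ⟨hHi, ?_⟩
  choose f' g' hf hg hfg using fun θ => exists_hasFDerivAt_primitive hΛ ha hb (hne θ)
  rw [← sub_eq_zero, ← MeasureTheory.integral_sub hGi hHi]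
  -- This form asks only for pointwise differentiability and an integrable divergence, so `η` need
  -- not be known to be C¹ at the axis.
  have key := MeasureTheory.integral_divergence_prod_Icc_of_hasFDerivAt_of_le
    (primitiveSnd Λ a b) (primitiveFst Λ a b) f' g' (0, 0) (2 * Real.pi, 2 * Real.pi)
    ⟨by positivity, by positivity⟩
    (fun θ _ => (hf θ).continuousAt.continuousWithinAt)
    (fun θ _ => (hg θ).continuousAt.continuousWithinAt) (fun θ _ => hf θ) (fun θ _ => hg θ)
    (by simp only [hfg]; rw [← hsq]; exact hGi.sub hHi)
  simp only [hfg] at key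
  rw [hsq, key]
  -- Opposite edges cancel: each coefficient involves the curve whose angle is fixed on its edges
  -- only through values, so periodicity of derivatives is not needed.
  simp [primitiveSnd, primitiveFst, torusPrimitive, diffCoord, heisHeight, hpa, hpb]

end Torus

/-! ### The pulled-back forms in coordinates. -/

theorem fderiv_euclDiff (P v : E3 × E3) : fderiv ℝ euclDiff P v = v.2 - v.1 := by
  have : HasFDerivAt euclDiff
      (ContinuousLinearMap.snd ℝ E3 E3 - ContinuousLinearMap.fst ℝ E3 E3) P :=
    hasFDerivAt_snd.sub hasFDerivAt_fst
  rw [this.fderiv]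
  rfl

theorem fderiv_apply_coord {F : Type*} [NormedAddCommGroup F] [NormedSpace ℝ F] {n : ℕ}
    {f : F → EuclideanSpace ℝ (Fin n)} {p : F} {i : Fin n} {f' : F →L[ℝ] ℝ}
    (hf : DifferentiableAt ℝ f p) (hi : HasFDerivAt (fun q => f q i) f' p) (v : F) :
    fderiv ℝ f p v i = f' v := by
  have h := (PiLp.proj 2 (fun _ : Fin n => ℝ) i : _ →L[ℝ] ℝ).hasFDerivAt.comp p hf.hasFDerivAt
  rw [hi.unique h]
  rfl

theorem hasFDerivAt_fst_coord (i : Fin 3) (P : E3 × E3) :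
    HasFDerivAt (fun Q : E3 × E3 => Q.1 i)
      ((EuclideanSpace.proj i : E3 →L[ℝ] ℝ) ∘L ContinuousLinearMap.fst ℝ E3 E3) P :=
  ((EuclideanSpace.proj i : E3 →L[ℝ] ℝ) ∘L ContinuousLinearMap.fst ℝ E3 E3).hasFDerivAt

theorem hasFDerivAt_snd_coord (i : Fin 3) (P : E3 × E3) :
    HasFDerivAt (fun Q : E3 × E3 => Q.2 i)
      ((EuclideanSpace.proj i : E3 →L[ℝ] ℝ) ∘L ContinuousLinearMap.snd ℝ E3 E3) P :=
  ((EuclideanSpace.proj i : E3 →L[ℝ] ℝ) ∘L ContinuousLinearMap.snd ℝ E3 E3).hasFDerivAt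

theorem heisDiff_zero (P : E3 × E3) : heisDiff P 0 = P.2 0 - P.1 0 := by
  simp [heisDiff, heisMul, heisInv]
  ring

theorem heisDiff_one (P : E3 × E3) : heisDiff P 1 = P.2 1 - P.1 1 := by
  simp [heisDiff, heisMul, heisInv]
  ring

theorem heisDiff_two (P : E3 × E3) :
    heisDiff P 2 = P.2 2 - P.1 2 + P.1 0 * P.2 1 - P.1 1 * P.2 0 := by
  simp [heisDiff, heisMul, heisInv]
  ring

theorem differentiable_heisDiff : Differentiable ℝ heisDiff := by
  intro P
  rw [differentiableAt_euclidean]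
  have h1 := fun i => (hasFDerivAt_fst_coord i P).differentiableAt
  have h2 := fun i => (hasFDerivAt_snd_coord i P).differentiableAt
  intro i
  fin_cases i
  · simp only [Fin.zero_eta, heisDiff_zero]
    exact (h2 0).sub (h1 0)
  · simp only [Fin.mk_one, heisDiff_one]
    exact (h2 1).sub (h1 1)
  · simp only [Fin.reduceFinMk, heisDiff_two]
    exact (((h2 2).sub (h1 2)).add ((h1 0).mul (h2 1))).sub ((h1 1).mul (h2 0))

theorem fderiv_heisDiff_zero (P v : E3 × E3) : fderiv ℝ heisDiff P v 0 = v.2 0 - v.1 0 := by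
  rw [fderiv_apply_coord (differentiable_heisDiff P) (f' := _) (by
    simp only [heisDiff_zero]
    exact (hasFDerivAt_snd_coord 0 P).sub (hasFDerivAt_fst_coord 0 P))]
  simp

theorem fderiv_heisDiff_one (P v : E3 × E3) : fderiv ℝ heisDiff P v 1 = v.2 1 - v.1 1 := by
  rw [fderiv_apply_coord (differentiable_heisDiff P) (f' := _) (by
    simp only [heisDiff_one]
    exact (hasFDerivAt_snd_coord 1 P).sub (hasFDerivAt_fst_coord 1 P))]
  simp

theorem fderiv_heisDiff_two (P v : E3 × E3) : fderiv ℝ heisDiff P v 2 =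
    v.2 2 - v.1 2 + (v.1 0 * P.2 1 + P.1 0 * v.2 1) - (v.1 1 * P.2 0 + P.1 1 * v.2 0) := by
  have h1 := fun i => hasFDerivAt_fst_coord i P
  have h2 := fun i => hasFDerivAt_snd_coord i P
  rw [fderiv_apply_coord (differentiable_heisDiff P) (f' := _) (by
    simp only [heisDiff_two]
    exact (((h2 2).sub (h1 2)).add ((h1 0).mul (h2 1))).sub ((h1 1).mul (h2 0)))]
  simp
  ring

theorem hasFDerivAt_coord_div_sqrt {p : E3} (hp : 0 < p 2) (i : Fin 3) :
    HasFDerivAt (fun q : E3 => q i / √(q 2))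
      ((1 / √(p 2)) • (EuclideanSpace.proj i : E3 →L[ℝ] ℝ)
        - (p i / (2 * p 2 * √(p 2))) • (EuclideanSpace.proj 2 : E3 →L[ℝ] ℝ)) p := by
  have hc := fun i : Fin 3 => (EuclideanSpace.proj i : E3 →L[ℝ] ℝ).hasFDerivAt (x := p)
  have hs := Real.sqrt_pos.2 hp
  have hsq := Real.sq_sqrt hp.le
  refine ((hc i).mul ((hasDerivAt_inv hs.ne').comp_hasFDerivAt p
    ((hc 2).sqrt hp.ne'))).congr_fderiv ?_
  ext v
  simp
  field_simp
  rw [hsq]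
  ring

theorem differentiableAt_planarRetraction {p : E3} (hp : 0 < p 2) :
    DifferentiableAt ℝ planarRetraction p := by
  rw [differentiableAt_euclidean]
  intro i
  fin_cases i
  · exact (hasFDerivAt_coord_div_sqrt hp 0).differentiableAt
  · exact (hasFDerivAt_coord_div_sqrt hp 1).differentiableAt

/-- One formula covers both cases of the definition, since `heatExp` vanishes for height `≤ 0`. -/
theorem heatForm_apply (Λ : ℝ) (p : E3) (v : Fin 2 → E3) :
    heatForm Λ p v = heatValue Λ (p 0) (p 1) (p 2) (v 0 0) (v 0 1) (v 0 2)
      (v 1 0) (v 1 1) (v 1 2) := by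
  rw [heatForm, heatValue]
  split_ifs with hp
  · have hs := Real.sqrt_pos.2 hp
    have hsq := Real.sq_sqrt hp.le
    have h0 := fderiv_apply_coord (i := 0) (differentiableAt_planarRetraction hp)
      (hasFDerivAt_coord_div_sqrt hp 0)
    have h1 := fderiv_apply_coord (i := 1) (differentiableAt_planarRetraction hp)
      (hasFDerivAt_coord_div_sqrt hp 1)
    have hexp : -Λ * ((p 0 / √(p 2)) ^ 2 + (p 1 / √(p 2)) ^ 2) / 2 =
        -Λ * (p 0 ^ 2 + p 1 ^ 2) / (2 * p 2) := by
      rw [div_pow, div_pow, hsq]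
      field_simp
    rw [heatExp_of_pos hp, ← hexp]
    simp [pullback, gaussianForm, wedge_apply, dcoord, h0, h1, planarRetraction]
    generalize Real.exp _ = E
    generalize √(p 2) = r at *
    field_simp
    rw [← hsq]
    ring
  · rw [heatExp_of_nonpos (not_lt.1 hp)]
    simp

theorem angularForm_apply (p : E3) (v : Fin 2 → E3) :
    angularForm p v = angularValue (p 0) (p 1) (p 2) (v 0 0) (v 0 1) (v 0 2)
      (v 1 0) (v 1 1) (v 1 2) := by
  have h : ((p 0) ^ 2 + (p 1) ^ 2 + (p 2) ^ 2) ^ (3 / 2 : ℝ) =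
      √((p 0) ^ 2 + (p 1) ^ 2 + (p 2) ^ 2) ^ 3 := by
    rw [Real.sqrt_eq_rpow, ← Real.rpow_mul_natCast (by positivity)]
    norm_num
  rw [angularForm, h, angularValue]
  simp [wedge_apply, dcoord]
  ring

theorem contDiff_comp_circleExp {X : Circle → E3} (hX : ContMDiff (𝓡 1) 𝓘(ℝ, E3) ∞ X) :
    ContDiff ℝ ∞ fun t : ℝ => X (Circle.exp t) :=
  (hX.comp contMDiff_circleExp).contDiff

/-- The coordinates of a closed curve, as functions of the angle. -/
def curveCoord (X : Circle → E3) (i : Fin 3) (t : ℝ) : ℝ := X (Circle.exp t) i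

theorem contDiff_curveCoord {X : Circle → E3} (hX : ContMDiff (𝓡 1) 𝓘(ℝ, E3) ∞ X) (i : Fin 3) :
    ContDiff ℝ 2 (curveCoord X i) :=
  contDiff_infty.1 (contDiff_euclidean.1 (contDiff_comp_circleExp hX) i) 2

theorem curveCoord_two_pi (X : Circle → E3) (i : Fin 3) :
    curveCoord X i (2 * Real.pi) = curveCoord X i 0 := by
  simp [curveCoord]

theorem deriv_curveCoord {X : Circle → E3} (hX : ContMDiff (𝓡 1) 𝓘(ℝ, E3) ∞ X) (i : Fin 3)
    (t : ℝ) : deriv (curveCoord X i) t = deriv (fun t : ℝ => X (Circle.exp t)) t i := by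
  have h := ((contDiff_comp_circleExp hX).differentiable (by simp) t).hasDerivAt
  have := (PiLp.proj 2 (fun _ : Fin 3 => ℝ) i : _ →L[ℝ] ℝ).hasFDerivAt.comp_hasDerivAt t h
  exact this.deriv

theorem fderiv_torusMap {X₁ X₂ : Circle → E3} (hX₁ : ContMDiff (𝓡 1) 𝓘(ℝ, E3) ∞ X₁)
    (hX₂ : ContMDiff (𝓡 1) 𝓘(ℝ, E3) ∞ X₂) (θ v : ℝ × ℝ) :
    fderiv ℝ (torusMap X₁ X₂) θ v =
      (v.1 • deriv (fun t : ℝ => X₁ (Circle.exp t)) θ.1,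
        v.2 • deriv (fun t : ℝ => X₂ (Circle.exp t)) θ.2) := by
  have h₁ := ((contDiff_comp_circleExp hX₁).differentiable (by simp) θ.1).hasDerivAt
  have h₂ := ((contDiff_comp_circleExp hX₂).differentiable (by simp) θ.2).hasDerivAt
  have h : HasFDerivAt (torusMap X₁ X₂) _ θ :=
    (h₁.hasFDerivAt.comp θ hasFDerivAt_fst).prodMk (h₂.hasFDerivAt.comp θ hasFDerivAt_snd)
  rw [h.fderiv]
  simp

theorem torusCoeff_angularForm {X₁ X₂ : Circle → E3} (hX₁ : ContMDiff (𝓡 1) 𝓘(ℝ, E3) ∞ X₁)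
    (hX₂ : ContMDiff (𝓡 1) 𝓘(ℝ, E3) ∞ X₂) :
    torusCoeff (pullback (torusMap X₁ X₂) (pullback euclDiff angularForm)) =
      gaussIntegrand (curveCoord X₁) (curveCoord X₂) := by
  ext θ
  simp [torusCoeff, pullback, angularForm_apply, fderiv_euclDiff, fderiv_torusMap hX₁ hX₂,
    gaussIntegrand, deriv_curveCoord hX₁, deriv_curveCoord hX₂, diffCoord, curveCoord, euclDiff,
    torusMap]

theorem torusCoeff_heatForm {X₁ X₂ : Circle → E3} (hX₁ : ContMDiff (𝓡 1) 𝓘(ℝ, E3) ∞ X₁)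
    (hX₂ : ContMDiff (𝓡 1) 𝓘(ℝ, E3) ∞ X₂) (Λ : ℝ) :
    torusCoeff (pullback (torusMap X₁ X₂) (pullback heisDiff (heatForm Λ))) =
      heatIntegrand Λ (curveCoord X₁) (curveCoord X₂) := by
  ext θ
  simp [torusCoeff, pullback, heatForm_apply, fderiv_heisDiff_zero, fderiv_heisDiff_one,
    fderiv_heisDiff_two, fderiv_torusMap hX₁ hX₂, heatIntegrand, deriv_curveCoord hX₁,
    deriv_curveCoord hX₂, diffCoord, heisHeight, curveCoord, heisDiff_zero, heisDiff_one,
    heisDiff_two, torusMap]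

theorem exists_curveCoord_ne {X₁ X₂ : Circle → E3}
    (hdisj : Disjoint (Set.range X₁) (Set.range X₂)) (θ : ℝ × ℝ) :
    ∃ i, curveCoord X₁ i θ.1 ≠ curveCoord X₂ i θ.2 := by
  by_contra! h
  have : X₁ (Circle.exp θ.1) = X₂ (Circle.exp θ.2) := by
    ext i
    exact h i
  exact Set.disjoint_left.1 hdisj ⟨_, rfl⟩ ⟨_, this.symm⟩

end HeisenbergLinking

end
open HeisenbergLinking in
theorem proposition1p1 (X₁ X₂ : Circle → E3)
    (hX₁ : ContMDiff (𝓡 1) 𝓘(ℝ, E3) ∞ X₁) (hX₂ : ContMDiff (𝓡 1) 𝓘(ℝ, E3) ∞ X₂)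
    (hdisj : Disjoint (Set.range X₁) (Set.range X₂)) (Λ : ℝ) (hΛ : 0 < Λ) :
    TorusFormIntegrable
        (pullback (torusMap X₁ X₂) (pullback heisDiff (heatForm Λ))) ∧
      linkingNumber X₁ X₂ =
        torusFormIntegral
          (pullback (torusMap X₁ X₂) (pullback heisDiff (heatForm Λ))) := by
  rw [TorusFormIntegrable, linkingNumber, torusFormIntegral, torusFormIntegral,
    torusCoeff_angularForm hX₁ hX₂, torusCoeff_heatForm hX₁ hX₂]
  exact integral_gaussIntegrand_eq hΛ (contDiff_curveCoord hX₁) (contDiff_curveCoord hX₂)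
    (exists_curveCoord_ne hdisj) (curveCoord_two_pi X₁) (curveCoord_two_pi X₂)
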